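/- **Theorem 4.2 (Weak Structure Theorem).** *Definitions.* A morphism of discrete cubes $\{0,1\}^k\to\{0,1\}^\ell$ is a map each of whose coordinates is identically $0$, identically $1$, some $x_j$, or some $1-x_j$. A cubespace is a metric space $X$ with closed sets $C^k(X)\subseteq X^{\{0,1\}^k}$ of $k$-cubes ($k\ge 0$), with $C^0(X)=X$, such that $c\circ\rho\in C^k(X)$ whenever $c\in C^\ell(X)$ and $\rho:\{0,1\}^k\to\{0,1\}^\ell$ is a morphism of discrete cubes. It is ergodic if $C^1(X)=X^2$. It has $k$-uniqueness if any two $k$-cubes that agree off the vertex $\vec 1=(1,\dots,1)$ are equal. It has $k$-completion if every map $\{0,1\}^k\setminus\{\vec 1\}\to X$ whose restrictions to the $k$ lower faces $\{\omega_i=0\}$ are $(k-1)$-cubes extends to a $k$-cube. A nilspace of degree $s$ is a cubespace with $k$-completion for all $k\ge 0$ such that $s$ is the smallest non-negative integer for which it has $(s+1)$-uniqueness. Write $x\sim_k y$ if there are $c,c'\in C^{k+1}(X)$ with $c(\vec 1)=x$, $c'(\vec 1)=y$ and $c(\omega)=c'(\omega)$ for all $\omega\neq\vec 1$. Let $\pi_k:X\to\pi_k(X)=X/{\sim_k}$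 be the projection, and let $C^n(\pi_k(X))$ be the image of $C^n(X)$ under pointwise application of $\pi_k$. For an abelian group $A$, let $C^k(\mathcal D_s(A))$ be the subgroup of $A^{\{0,1\}^k}$ generated by the configurations equal to $x$ on the face $\{\omega:\omega_i=1\ \forall i\in S\}$ and to $0$ elsewhere, where $S\subseteq\{1,\dots,k\}$, $|S|\le s$ and $x\in A$ (the Host–Kra cubes for the filtration $A=A_0=\dots=A_s\supseteq A_{s+1}=\{0\}$). *Statement.* Let $X$ be a compact ergodic nilspace of degree $s\ge 1$. Then $\sim_{s-1}$ is a closed equivalence relation on $X$, and there exists a compact (Hausdorff topological) abelian group $A=A_s(X)$ acting continuously on $X$ such that: 1. the action of $A$ on $X$ is free, and its orbits are precisely the fibres of $\pi_{s-1}:X\to\pi_{s-1}(X)$; 2. for every $k\ge 0$ this induces, pointwise, an action of $C^k(\mathcal D_s(A))$ on $C^k(X)$; this action is free, and its orbits are precisely the fibres of the induced map $C^k(X)\to C^k(\pi_{s-1}(X))$. -/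

import Mathlib

universe u

/-- The discrete cube `{0,1}^k`; `true` is `1` and `false` is `0`. -/
abbrev DCube (k : ℕ) : Type := Fin k → Bool

namespace DCube

/-- The vertex `(1, …, 1)`. -/
def one (k : ℕ) : DCube k := fun _ => true

/-- Morphisms of discrete cubes: each coordinate of the map is identically `0`, identically `1`,
a coordinate `x_j`, or `1 - x_j`. -/
def IsMorphism {k l : ℕ} (ρ : DCube k → DCube l) : Prop :=
  ∀ i : Fin l, (∀ x, ρ x i = false) ∨ (∀ x, ρ x i = true) ∨
    (∃ j : Fin k, ∀ x, ρ x i = x j) ∨ (∃ j : Fin k, ∀ x, ρ x i = !(x j))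

/-- The embedding `(ω_1, …, ω_k) ↦ (ω_1, …, ω_{i-1}, 0, ω_i, …, ω_k)` onto a lower face. -/
def lowerFace {k : ℕ} (i : Fin (k + 1)) (ω : DCube k) : DCube (k + 1) :=
  i.insertNth (α := fun _ => Bool) false ω

theorem lowerFace_ne_one {k : ℕ} (i : Fin (k + 1)) (ω : DCube k) :
    lowerFace i ω ≠ one (k + 1) := by
  intro h
  have := congrFun h i
  simp [lowerFace, one] at this

end DCube

/-- The combinatorial part of a cubespace: sets of `k`-cubes, stable under morphisms of discrete
cubes, such that every point is a `0`-cube. -/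
class CubeStructure (X : Type u) where
  cubes : ∀ k : ℕ, Set (DCube k → X)
  comp_mem : ∀ {k l : ℕ} (ρ : DCube k → DCube l), DCube.IsMorphism ρ →
    ∀ c ∈ cubes l, c ∘ ρ ∈ cubes k
  cubes_zero : cubes 0 = Set.univ

/-- A cubespace: a metric space with sets of cubes that are closed in the product topology. -/
class Cubespace (X : Type u) [MetricSpace X] extends CubeStructure X where
  isClosed_cubes : ∀ k : ℕ, IsClosed (cubes k)

namespace CubeStructure

variable (X : Type u) [CubeStructure X]

/-- `k`-uniqueness. -/
def HasUniqueness (k : ℕ) : Prop :=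
  ∀ c ∈ cubes (X := X) k, ∀ c' ∈ cubes (X := X) k,
    (∀ ω, ω ≠ DCube.one k → c ω = c' ω) → c = c'

/-- `k`-corners: maps on `{0,1}^k` minus the vertex `(1, …, 1)` all of whose lower faces are
`(k-1)`-cubes. For `k = 0` there are no lower faces, and the empty map is a corner. -/
def IsCorner : (k : ℕ) → ({ω : DCube k // ω ≠ DCube.one k} → X) → Prop
  | 0, _ => True
  | k + 1, l => ∀ i : Fin (k + 1),
      (fun ω : DCube k => l ⟨DCube.lowerFace i ω, DCube.lowerFace_ne_one i ω⟩) ∈ cubes (X := X) k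

/-- `k`-completion: every `k`-corner extends to a `k`-cube. -/
def HasCompletion (k : ℕ) : Prop :=
  ∀ l : {ω : DCube k // ω ≠ DCube.one k} → X, IsCorner X k l →
    ∃ c ∈ cubes (X := X) k, ∀ ω : {ω : DCube k // ω ≠ DCube.one k}, c ω = l ω

/-- Nilspaces of degree `s`: completion in every dimension, and `s` is the smallest natural number
such that `(s+1)`-uniqueness holds. -/
def IsNilspaceOfDegree (s : ℕ) : Prop :=
  (∀ k, HasCompletion X k) ∧ IsLeast {t : ℕ | HasUniqueness X (t + 1)} s

/-- Ergodicity: every pair of points is a `1`-cube. -/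
def IsErgodic : Prop := cubes (X := X) 1 = Set.univ

/-- The canonical relation `∼_k`. -/
def CanonicalRel (k : ℕ) (x y : X) : Prop :=
  ∃ c ∈ cubes (X := X) (k + 1), ∃ c' ∈ cubes (X := X) (k + 1),
    c (DCube.one (k + 1)) = x ∧ c' (DCube.one (k + 1)) = y ∧
      ∀ ω, ω ≠ DCube.one (k + 1) → c ω = c' ω

/-- The quotient cube structure: the cubes of the quotient are the images of the cubes. -/
instance quotient (r : X → X → Prop) : CubeStructure (Quot r) where
  cubes k := (fun c : DCube k → X => Quot.mk r ∘ c) '' cubes k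
  comp_mem := by
    rintro k l ρ hρ _ ⟨c, hc, rfl⟩
    exact ⟨c ∘ ρ, comp_mem ρ hρ c hc, rfl⟩
  cubes_zero := by
    refine Set.eq_univ_of_forall fun c => ⟨fun ω => (c ω).out, ?_, ?_⟩
    · rw [cubes_zero]
      exact Set.mem_univ _
    · funext ω
      exact Quot.out_eq (c ω)

/-- The canonical factor `π_k(X) = X / ∼_k`, with the quotient cube structure. -/
abbrev CanonicalFactor (k : ℕ) : Type u := Quot (CanonicalRel X k)

/-- The canonical projection `π_k : X → π_k(X)`. -/
def canonicalProj (k : ℕ) (x : X) : CanonicalFactor X k := Quot.mk _ x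

/-- The induced map `C^n(X) → C^n(π_k(X))`. -/
def canonicalProjCubes (k n : ℕ) (c : cubes (X := X) n) :
    cubes (X := CanonicalFactor X k) n :=
  ⟨fun ω => canonicalProj X k (c.1 ω), c.1, c.2, rfl⟩

end CubeStructure

section HostKra

variable {A : Type u} [AddCommGroup A]

open Classical in
/-- The configuration `[x]_{F_S}`, equal to `x` on the upper face
`F_S = {ω : ω_i = 1 for all i ∈ S}` and to `0` elsewhere. -/
noncomputable def upperFaceConfig {k : ℕ} (S : Finset (Fin k)) (x : A) : DCube k → A :=
  fun ω => if ∀ i ∈ S, ω i = true then x else 0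

/-- The Host–Kra cube group `HK^k(G_•)` of a filtration `G_•` on an abelian group: the subgroup of
`A^{{0,1}^k}` generated by the `[x]_{F_S}` with `x ∈ G_{|S|}`. -/
def hostKra (G : ℕ → AddSubgroup A) (k : ℕ) : AddSubgroup (DCube k → A) :=
  AddSubgroup.closure {f | ∃ S : Finset (Fin k), ∃ x ∈ G S.card, f = upperFaceConfig S x}

variable (A) in
/-- The filtration `A = A_0 = A_1 = ⋯ = A_s ⊇ A_{s+1} = {0}`. -/
def degreeFiltration (s : ℕ) (i : ℕ) : AddSubgroup A := if i ≤ s then ⊤ else ⊥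

variable (A) in
/-- The group `C^k(D_s(A))` of `k`-cubes of `D_s(A)`. -/
def degreeCubes (s k : ℕ) : AddSubgroup (DCube k → A) := hostKra (degreeFiltration A s) k

end HostKra

/-!
The proof works with cubes `{0,1}^ι → X` over arbitrary finite coordinate sets `ι` (`IsCube`) and
rests on two consequences of completion. A map on a lower set of vertices that is a cube on each
face below a vertex of the set extends to a cube (`exists_isCube_extension`). Applied in
`{0,1}^(ι × Bool)`, this shows that `2^ι` cubes around a common vertex may be glued to one cube
(`isCube_outer`), and hence that the values of a cube on an upper face may be exchanged whenever
some pair of cubes realizes the exchange (`isCube_replace`). In particular `∼_r` is an equivalence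
relation, and it is closed because `x ∼_r y` says that `(x, …, x, y)` is an `(r + 1)`-cube.

Write the degree as `r + 1`. The pairs `(x, y)` and `(x', y')` of equivalent points are parallel
(`Parallel`) if the `(r + 2)`-configuration with the edge `(y, y')` at the top and the edges
`(x, x')` elsewhere is a cube. Given `x ∼_r y` and `x'` there is exactly one such `y'`, by
completion and uniqueness, and replacement and gluing make parallelism compatible with composition
of pairs.
The structure group is the fibre of a base point `e`, where `a + x` is the point for which `(e, a)`
and `(x, a + x)` are parallel. Commutativity comes from translating a constant cube along two edges
that meet in the top vertex only. The graph of the action is closed, and all spaces are compact, so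
that the action is continuous.

A translation may be applied along any edge of an `(r + 2)`-cube. A configuration all of whose
`(r + 2)`-dimensional faces are cubes is itself a cube (`isCube_of_faces`), and an upper face of
codimension at most `r + 1` meets such a face in a union of parallel edges; so the Host–Kra cubes of
the structure group act on cubes (`StructureGroup.vadd_mem_cubes`). Conversely, if two cubes lie in
the same fibres, generators correct one to the other at the vertices of weight at most `r + 1`, and
uniqueness does the rest (`StructureGroup.exists_degreeCubes_vadd_eq`).
-/

/-! ### Cubes over arbitrary finite coordinate sets -/

namespace CubeStructure

/-- Morphisms of discrete cubes whose coordinates are indexed by arbitrary types. -/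
def IsCubeMorphism {ι κ : Type*} (ρ : (ι → Bool) → κ → Bool) : Prop :=
  ∀ i : κ, (∀ x, ρ x i = false) ∨ (∀ x, ρ x i = true) ∨
    (∃ j : ι, ∀ x, ρ x i = x j) ∨ (∃ j : ι, ∀ x, ρ x i = !(x j))

/-- A map on `{0,1}^ι` is a cube if it is one of the given `k`-cubes after some (equivalently, any)
enumeration of the finite type `ι` by `Fin k`. -/
def IsCube {X : Type u} [CubeStructure X] {ι : Type*} (f : (ι → Bool) → X) : Prop :=
  ∃ (k : ℕ) (e : ι ≃ Fin k), (fun ω : DCube k => f (ω ∘ e)) ∈ cubes (X := X) k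

variable {X : Type u} [CubeStructure X] {ι κ : Type*}

theorem IsCube.comp [Finite κ] {f : (ι → Bool) → X} (hf : IsCube f)
    {ρ : (κ → Bool) → ι → Bool} (hρ : IsCubeMorphism ρ) : IsCube (fun ω => f (ρ ω)) := by
  obtain ⟨k, e, h⟩ := hf
  obtain ⟨l, ⟨e'⟩⟩ := Finite.exists_equiv_fin κ
  refine ⟨l, e', ?_⟩
  have hmor : DCube.IsMorphism (fun (ω : DCube l) (i : Fin k) => ρ (ω ∘ e') (e.symm i)) := by
    intro i
    rcases hρ (e.symm i) with h | h | ⟨j, h⟩ | ⟨j, h⟩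
    · exact Or.inl fun x => h _
    · exact Or.inr (Or.inl fun x => h _)
    · exact Or.inr (Or.inr (Or.inl ⟨e' j, fun x => h _⟩))
    · exact Or.inr (Or.inr (Or.inr ⟨e' j, fun x => h _⟩))
  have := comp_mem (X := X) _ hmor _ h
  convert this using 1
  funext ω
  simp [Function.comp_def]

theorem isCube_iff_mem {k : ℕ} {f : DCube k → X} : IsCube f ↔ f ∈ cubes (X := X) k := by
  refine ⟨fun ⟨l, e, h⟩ => ?_, fun h => ⟨k, Equiv.refl _, h⟩⟩
  have hmor : DCube.IsMorphism (fun (ω : DCube k) (i : Fin l) => ω (e.symm i)) :=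
    fun i => Or.inr (Or.inr (Or.inl ⟨e.symm i, fun x => rfl⟩))
  have := comp_mem (X := X) _ hmor _ h
  convert this using 1
  funext ω
  simp [Function.comp_def]

theorem isCube_const [Finite ι] (x : X) : IsCube (fun _ : ι → Bool => x) := by
  have h : IsCube (fun _ : DCube 0 => x) := by
    rw [isCube_iff_mem, cubes_zero]
    exact Set.mem_univ _
  exact h.comp (ρ := fun _ => Fin.elim0) fun i => i.elim0

/-- The point of the face through `b` with free coordinates `{i | v i}` whose free coordinates are
those of `ω`. -/
def facePoint (v ω b : ι → Bool) : ι → Bool := fun i => if v i then ω i else b i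

@[simp]
theorem facePoint_true (ω b : ι → Bool) : facePoint (fun _ => true) ω b = ω := by
  funext i
  simp [facePoint]

theorem isCubeMorphism_facePoint (v b : ι → Bool) :
    IsCubeMorphism (fun ω => facePoint v ω b) := by
  intro i
  by_cases h : v i = true
  · exact Or.inr (Or.inr (Or.inl ⟨i, fun x => by simp [facePoint, h]⟩))
  · by_cases h' : b i = true
    · exact Or.inr (Or.inl fun x => by simp [facePoint, h, h'])
    · exact Or.inl fun x => by simpa [facePoint, h] using h'

/-- Completion of a corner that sits on a face of a larger cube. -/
theorem exists_isCube_of_corner (hX : ∀ k, HasCompletion X k) [Finite ι] [DecidableEq ι]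
    (f : (ι → Bool) → X) (v b : ι → Bool)
    (h : ∀ i, v i = true → IsCube (fun ω => f (facePoint v (Function.update ω i false) b))) :
    ∃ c : (ι → Bool) → X, IsCube c ∧
      ∀ ω, ¬ v ≤ ω → c ω = f (facePoint v ω b) := by
  obtain ⟨k, ⟨e⟩⟩ := Finite.exists_equiv_fin {i // v i = true}
  set emb : DCube k → ι → Bool := fun ω i => if h : v i = true then ω (e ⟨i, h⟩) else b i with hemb
  have hcorner : IsCorner X k (fun ω => f (emb ω.1)) := by
    cases k with
    | zero => trivial
    | succ k =>
      intro i
      rw [← isCube_iff_mem]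
      have h1 := (h (e.symm i).1 (e.symm i).2).comp
        (ρ := fun ω : DCube k => emb (DCube.lowerFace i ω)) ?_
      · convert h1 using 3 with ω
        funext j
        by_cases hj : v j = true
        · by_cases hji : j = (e.symm i).1
          · subst hji
            simp [hemb, facePoint, DCube.lowerFace, hj]
          · simp [hemb, facePoint, hj, Function.update_of_ne hji]
        · simp [hemb, facePoint, hj]
      · intro j
        by_cases hj : v j = true
        · by_cases hji : e ⟨j, hj⟩ = i
          · exact Or.inl fun x => by simp [hemb, hj, hji, DCube.lowerFace]
          · obtain ⟨m, hm⟩ := Fin.exists_succAbove_eq hji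
            exact Or.inr (Or.inr (Or.inl ⟨m, fun x => by
              simp [hemb, hj, ← hm, DCube.lowerFace]⟩))
        · by_cases hb : b j = true
          · exact Or.inr (Or.inl fun x => by simp [hemb, hj, hb])
          · exact Or.inl fun x => by simpa [hemb, hj] using hb
  obtain ⟨c, hc, hcl⟩ := hX k _ hcorner
  refine ⟨fun ω => c (fun j => ω (e.symm j).1), (isCube_iff_mem.2 hc).comp
    (fun i => Or.inr (Or.inr (Or.inl ⟨(e.symm i).1, fun x => rfl⟩))), fun ω hω => ?_⟩
  have hne : (fun j => ω (e.symm j).1) ≠ DCube.one k := by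
    intro h0
    refine hω fun i => Bool.le_iff_imp.2 fun hi => ?_
    have := congrFun h0 (e ⟨i, hi⟩)
    simpa [DCube.one] using this
  have := hcl ⟨_, hne⟩
  refine this.trans (congrArg f ?_)
  funext i
  by_cases hi : v i = true <;> simp [hemb, facePoint, hi]

/-- In a finite partial order every lower set can be exhausted by adding minimal elements of its
complement one at a time. -/
theorem lowerSet_induction {α : Type*} [Finite α] [PartialOrder α] {P : Set α → Prop}
    (step : ∀ (D : Set α) (v : α), IsLowerSet D → v ∉ D → (∀ w, w < v → w ∈ D) → P D →
      P (insert v D))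
    (D : Set α) (hD : IsLowerSet D) (h : P D) : P Set.univ := by
  induction hn : Dᶜ.ncard using Nat.strong_induction_on generalizing D with
  | _ n ih =>
    rcases Set.eq_empty_or_nonempty Dᶜ with h0 | h0
    · rwa [← Set.compl_empty_iff.1 h0]
    · obtain ⟨v, hv⟩ := (Set.toFinite Dᶜ).exists_minimal h0
      have hlt : ∀ w, w < v → w ∈ D := fun w hw => by
        by_contra hwD
        exact absurd (hv.2 hwD hw.le) (not_le_of_gt hw)
      refine ih _ ?_ (insert v D) ?_ (step D v hD hv.1 hlt h) rfl
      · rw [← hn]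
        refine Set.ncard_lt_ncard ⟨Set.compl_subset_compl.2 (Set.subset_insert _ _), fun hs => ?_⟩
        exact hs hv.1 (Set.mem_insert _ _)
      · rintro a b hab (rfl | ha)
        · rcases hab.eq_or_lt with rfl | hlt'
          · exact Set.mem_insert _ _
          · exact Set.mem_insert_of_mem _ (hlt _ hlt')
        · exact Set.mem_insert_of_mem _ (hD hab ha)

open Classical in
/-- A map on a lower set of vertices all of whose restrictions to the faces `{ω | ω ≤ v}` are cubes
extends to a cube: fill in the missing vertices in increasing order, each one completing a
corner. -/
theorem exists_isCube_extension (hX : ∀ k, HasCompletion X k) [Finite ι]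
    (D : Set (ι → Bool)) (hD : IsLowerSet D) (f : (ι → Bool) → X)
    (h : ∀ v ∈ D, IsCube (fun ω => f (facePoint v ω fun _ => false))) :
    ∃ F : (ι → Bool) → X, IsCube F ∧ ∀ v ∈ D, F v = f v := by
  obtain ⟨F, hF, hFD⟩ : ∃ F : (ι → Bool) → X,
      (∀ v ∈ Set.univ, IsCube (fun ω => F (facePoint v ω fun _ => false))) ∧
        ∀ v ∈ D, v ∈ Set.univ ∧ F v = f v := by
    refine lowerSet_induction
      (P := fun E => ∃ F : (ι → Bool) → X,
        (∀ v ∈ E, IsCube (fun ω => F (facePoint v ω fun _ => false))) ∧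
          ∀ v ∈ D, v ∈ E ∧ F v = f v)
      ?_ D hD ⟨f, h, fun v hv => ⟨hv, rfl⟩⟩
    rintro E v hE hv hlt ⟨F, hF, hFD⟩
    obtain ⟨c, hc, hcF⟩ := exists_isCube_of_corner hX F v (fun _ => false) fun i hi => by
      convert hF (Function.update v i false) (hlt _ ?_) using 3 with ω
      · funext j
        by_cases hj : j = i
        · subst hj; simp [facePoint]
        · simp [facePoint, Function.update_of_ne hj]
      · refine lt_of_le_of_ne (update_le_self_iff.2 (Bool.false_le _)) ?_
        intro h0
        have := congrFun h0 i
        simp [hi] at this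
    refine ⟨Function.update F v (c v), ?_, fun w hw => ⟨Set.mem_insert_of_mem _ (hFD w hw).1, ?_⟩⟩
    · rintro w (rfl | hw)
      · convert hc.comp (isCubeMorphism_facePoint w fun _ => false) using 2 with ω
        by_cases hω : w ≤ ω
        · have : facePoint w ω (fun _ => false) = w := by
            funext i
            have := Bool.le_iff_imp.1 (hω i)
            cases hi : w i <;> simp_all [facePoint]
          simp [this]
        · have hle : ¬ w ≤ facePoint w ω fun _ => false := fun h0 => hω fun i => by
            have := h0 i
            cases hi : w i <;> simp_all [facePoint]
          have hne : facePoint w ω (fun _ => false) ≠ w := fun h0 => hle h0.ge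
          rw [Function.update_of_ne hne, hcF _ hle]
          congr 1
          funext i
          simp [facePoint]
      · convert hF w hw using 2 with ω
        refine Function.update_of_ne (fun h0 => hv (hE ?_ hw)) _ _
        rw [← h0]
        intro i
        cases hi : w i <;> simp [facePoint, hi]
    · rw [Function.update_of_ne, (hFD w hw).2]
      rintro rfl
      exact hv (hFD w hw).1
  refine ⟨F, ?_, fun v hv => (hFD v hv).2⟩
  convert hF (fun _ => true) (Set.mem_univ _) using 1
  simp

/-- Gluing `2^ι` cubes around a common vertex: if `g` is a map on `{-1,0,1}^ι` (with `none` in the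
role of `0`) that is a cube on each of the `2^ι` small cubes containing the centre, then its
restriction to the outer vertices is a cube. -/
theorem isCube_outer (hX : ∀ k, HasCompletion X k) [Finite ι] (g : (ι → Option Bool) → X)
    (h : ∀ ε : ι → Bool, IsCube (fun ω : ι → Bool =>
      g fun i => if ω i then some (ε i) else none)) :
    IsCube (fun ε : ι → Bool => g fun i => some (ε i)) := by
  -- Each coordinate `{-1,0,1}` becomes the lower set `{(0,1), (0,0), (1,0)}` of `{0,1}^2`, whose
  -- outer points are the image of the antidiagonal morphism `x ↦ (x, 1 - x)`.
  let D : Set (ι × Bool → Bool) := {v | ∀ i, ¬ (v (i, true) = true ∧ v (i, false) = true)}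
  have hD : IsLowerSet D := fun v w hwv hv i hi =>
    hv i ⟨Bool.le_iff_imp.1 (hwv _) hi.1, Bool.le_iff_imp.1 (hwv _) hi.2⟩
  let f : (ι × Bool → Bool) → X := fun v => g fun i =>
    if v (i, true) then some true else if v (i, false) then some false else none
  have hf : ∀ v ∈ D, IsCube (fun ω => f (facePoint v ω fun _ => false)) := by
    intro v hv
    convert (h fun i => v (i, true)).comp
      (ρ := fun (ω : ι × Bool → Bool) i => v (i, v (i, true)) && ω (i, v (i, true))) ?_ using 3
      with ω
    · funext i
      have := hv i
      cases h1 : v (i, true) <;> cases h2 : v (i, false) <;> simp_all [facePoint]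
    · intro i
      by_cases hi : v (i, v (i, true)) = true
      · exact Or.inr (Or.inr (Or.inl ⟨_, fun x => by simp [hi]; rfl⟩))
      · exact Or.inl fun x => by simp [hi]
  obtain ⟨F, hF, hFD⟩ := exists_isCube_extension hX D hD f hf
  convert hF.comp (ρ := fun (ε : ι → Bool) p => if p.2 then ε p.1 else !(ε p.1)) ?_ using 2 with ε
  · rw [hFD]
    · refine congrArg g (funext fun i => ?_)
      cases hi : ε i <;> simp [hi]
    · intro i
      cases ε i <;> simp
  · rintro ⟨i, b⟩
    cases b
    · exact Or.inr (Or.inr (Or.inr ⟨i, fun x => rfl⟩))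
    · exact Or.inr (Or.inr (Or.inl ⟨i, fun x => rfl⟩))

open Classical in
/-- Replacement on a face: if two cubes `c`, `c'` agree off the upper face `{ω | S ≤ ω}`, then in
every cube `d` that agrees with `c` on that face, the values on the face may be replaced by those
of `c'`. -/
theorem isCube_replace (hX : ∀ k, HasCompletion X k) [Finite ι] (S : ι → Bool)
    {c c' d : (ι → Bool) → X} (hc : IsCube c) (hc' : IsCube c') (hd : IsCube d)
    (hcc' : ∀ ω, ¬ S ≤ ω → c ω = c' ω) (hdc : ∀ ω, S ≤ ω → d ω = c ω) :
    IsCube (fun ω => if S ≤ ω then c' ω else d ω) := by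
  -- The conclusion for `d = c ∘ (S ⊔ ·)`, by gluing `2^S` copies of `c` at the opposite vertex and
  -- replacing one of them by `c'`.
  have h1 : IsCube (fun ω => if S ≤ ω then c' ω else c (S ⊔ ω)) := by
    have h := isCube_outer hX (fun p : ι → Option Bool =>
      let m : ι → Bool := fun i => if S i then (p i).isSome else (p i == some true)
      if ∀ i, S i = true → p i = some true then c' m else c m) ?_
    · convert h using 2 with ε
      have e1 : (∀ i, S i = true → some (ε i) = some true) ↔ S ≤ ε := by
        simp [Pi.le_def, Bool.le_iff_imp]
      have e2 : (fun i => if S i then (some (ε i)).isSome else (some (ε i) == some true)) =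
          S ⊔ ε := by
        funext i
        cases hi : S i <;> cases hε : ε i <;> simp [hi, hε]
      simp only [e1, e2]
      by_cases hS : S ≤ ε
      · simp [hS]
      · simp [hS]
    · intro ε
      by_cases hε : S ≤ ε
      · convert hc'.comp (isCubeMorphism_facePoint (S ⊔ ε) fun _ => false) using 2 with ω
        have e2 : (fun i => if S i then (if ω i then some (ε i) else none).isSome else
            ((if ω i then some (ε i) else none) == some true)) =
            facePoint (S ⊔ ε) ω fun _ => false := by
          funext i
          cases hi : S i <;> cases hεi : ε i <;> cases hω : ω i <;> simp [facePoint, hi, hεi, hω]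
        simp only [e2]
        split_ifs with hs
        · rfl
        · refine hcc' _ fun h0 => hs fun i hi => ?_
          have h2 := Bool.le_iff_imp.1 (h0 i) hi
          have h3 := Bool.le_iff_imp.1 (hε i) hi
          simp [facePoint, hi] at h2
          simp [h2, h3]
      · convert hc.comp (isCubeMorphism_facePoint (S ⊔ ε) fun _ => false) using 2 with ω
        have e2 : (fun i => if S i then (if ω i then some (ε i) else none).isSome else
            ((if ω i then some (ε i) else none) == some true)) =
            facePoint (S ⊔ ε) ω fun _ => false := by
          funext i
          cases hi : S i <;> cases hεi : ε i <;> cases hω : ω i <;> simp [facePoint, hi, hεi, hω]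
        simp only [e2]
        split_ifs with hs
        · refine absurd (fun i => Bool.le_iff_imp.2 fun hi => ?_) hε
          have := hs i hi
          split_ifs at this
          simpa using this
        · rfl
  -- The general case, by gluing `2^S` degenerate copies of `d` at their faces over `S`.
  have h := isCube_outer hX (fun p : ι → Option Bool =>
    let m : ι → Bool := fun i => if S i then (p i != some false) else (p i == some true)
    if ∀ i, S i = true → p i = some true then c' m else d m) ?_
  · convert h using 2 with ε
    have e1 : (∀ i, S i = true → some (ε i) = some true) ↔ S ≤ ε := by
      simp [Pi.le_def, Bool.le_iff_imp]
    have e2 : (fun i => if S i then (some (ε i) != some false) else (some (ε i) == some true)) =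
        ε := by
      funext i
      cases hi : S i <;> cases hε : ε i <;> simp [bne]
    simp only [e1, e2]
  · intro ε
    by_cases hε : S ≤ ε
    · convert h1.comp (isCubeMorphism_facePoint (S ⊔ ε) fun _ => false) using 2 with ω
      have e1 : (∀ i, S i = true → (if ω i then some (ε i) else none) = some true) ↔
          S ≤ facePoint (S ⊔ ε) ω fun _ => false := by
        rw [Pi.le_def]
        refine forall_congr' fun i => ?_
        have := Bool.le_iff_imp.1 (hε i)
        cases hi : S i <;> cases hεi : ε i <;> cases hω : ω i <;> simp_all [facePoint]
      have e2 : (fun i => if S i then ((if ω i then some (ε i) else none) != some false) else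
          ((if ω i then some (ε i) else none) == some true)) =
          S ⊔ facePoint (S ⊔ ε) ω fun _ => false := by
        funext i
        have := Bool.le_iff_imp.1 (hε i)
        cases hi : S i <;> cases hεi : ε i <;> cases hω : ω i <;> simp_all [facePoint, bne]
      simp only [e1, e2]
      split_ifs with hs
      · rw [sup_eq_right.2 hs]
      · exact hdc _ le_sup_left
    · convert hd.comp (ρ := fun ω i => if S i then (ε i || !(ω i)) else ε i && ω i) ?_
          using 2 with ω
      · split_ifs with hs
        · refine absurd (fun i => Bool.le_iff_imp.2 fun hi => ?_) hε
          have : (if ω i then some (ε i) else none) = some true := hs i hi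
          split_ifs at this
          simpa using this
        · refine congrArg d (funext fun i => ?_)
          cases hi : S i <;> cases hεi : ε i <;> cases hω : ω i <;> simp [hεi, hω, bne]
      · intro i
        cases hi : S i <;> cases hεi : ε i
        · exact Or.inl fun x => by simp [hi, hεi]
        · exact Or.inr (Or.inr (Or.inl ⟨i, fun x => by simp [hi, hεi]⟩))
        · exact Or.inr (Or.inr (Or.inr ⟨i, fun x => by simp [hi, hεi]⟩))
        · exact Or.inr (Or.inl fun x => by simp [hi, hεi])

end CubeStructure

/-! ### The canonical relation -/

namespace CubeStructure

variable {X : Type u} [CubeStructure X] {ι : Type*} {r : ℕ}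

theorem true_le_iff {ω : ι → Bool} : (fun _ => true) ≤ ω ↔ ω = fun _ => true :=
  ⟨fun h => le_antisymm (fun _ => Bool.le_true _) h, fun h => h.ge⟩

open Classical in
theorem canonicalRel_iff (hX : ∀ k, HasCompletion X k) {x y : X} :
    CanonicalRel X r x y ↔
      IsCube (fun ω : Fin (r + 1) → Bool => if (fun _ => true) ≤ ω then y else x) := by
  constructor
  · rintro ⟨c, hc, c', hc', rfl, rfl, h⟩
    rw [← isCube_iff_mem] at hc hc'
    convert isCube_replace hX (fun _ => true) hc hc' (isCube_const (c (DCube.one _)))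
      (fun ω hω => h ω fun h0 => hω (true_le_iff.2 h0)) fun ω hω => ?_ using 3 with ω hω
    · rw [true_le_iff.1 hω]; rfl
    · rw [true_le_iff.1 hω]; rfl
  · intro h
    refine ⟨_, isCube_iff_mem.1 (isCube_const x), _, isCube_iff_mem.1 h, rfl, ?_, fun ω hω => ?_⟩
    · exact if_pos le_rfl
    · exact (if_neg fun h0 => hω (true_le_iff.1 h0)).symm

theorem equivalence_canonicalRel (hX : ∀ k, HasCompletion X k) :
    Equivalence (CanonicalRel X r) where
  refl x := ⟨_, isCube_iff_mem.1 (isCube_const x), _, isCube_iff_mem.1 (isCube_const x), rfl, rfl,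
    fun _ _ => rfl⟩
  symm := fun ⟨c, hc, c', hc', hx, hy, h⟩ => ⟨c', hc', c, hc, hy, hx, fun ω hω => (h ω hω).symm⟩
  trans := by
    classical
    rintro x y z ⟨c, hc, c', hc', rfl, rfl, h⟩ ⟨d, hd, d', hd', hdy, rfl, h'⟩
    have := isCube_replace hX (fun _ => true) (isCube_iff_mem.2 hd) (isCube_iff_mem.2 hd')
      (isCube_iff_mem.2 hc') (fun ω hω => h' ω fun h0 => hω (true_le_iff.2 h0))
      fun ω hω => by rw [true_le_iff.1 hω]; exact hdy.symm
    refine ⟨c, hc, _, isCube_iff_mem.1 this, rfl, if_pos le_rfl, fun ω hω => ?_⟩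
    rw [if_neg fun h0 => hω (true_le_iff.1 h0)]
    exact h ω hω

theorem isClosed_canonicalRel {X : Type u} [MetricSpace X] [Cubespace X]
    (hX : ∀ k, HasCompletion X k) :
    IsClosed {p : X × X | CanonicalRel X r p.1 p.2} := by
  classical
  simp only [canonicalRel_iff hX, isCube_iff_mem]
  refine (Cubespace.isClosed_cubes (r + 1)).preimage
    (f := fun (p : X × X) (ω : DCube (r + 1)) => if (fun _ => true) ≤ ω then p.2 else p.1) ?_
  refine continuous_pi fun ω => ?_
  split_ifs
  · exact continuous_snd
  · exact continuous_fst

/-! ### Parallel pairs of points in a common fibre -/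

/-- Ergodic cubespaces with completion in every dimension and `(r + 2)`-uniqueness, that is, ergodic
nilspaces of degree at most `r + 1`. -/
class ErgodicNilspace (X : Type u) [CubeStructure X] (r : ℕ) : Prop where
  completion : ∀ k, HasCompletion X k
  uniqueness : HasUniqueness X (r + 2)
  ergodic : IsErgodic X

open ErgodicNilspace

theorem isCube_pair [Finite ι] [ErgodicNilspace X r] (i : ι) (x y : X) :
    IsCube (fun ω : ι → Bool => if ω i then y else x) := by
  have h : IsCube (fun ω : DCube 1 => if ω 0 then y else x) := by
    have := ergodic (X := X) (r := r)
    rw [isCube_iff_mem, show cubes (X := X) 1 = Set.univ from this]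
    exact Set.mem_univ _
  exact h.comp (ρ := fun ω _ => ω i) fun _ => Or.inr (Or.inr (Or.inl ⟨i, fun _ => rfl⟩))

/-- `(r + 2)`-uniqueness on the face of a larger cube through the top vertex whose free coordinates
are the image of `φ`. -/
theorem eq_of_eq_off_top [Finite ι] [ErgodicNilspace X r] (φ : Fin (r + 2) ↪ ι)
    {f g : (ι → Bool) → X} (hf : IsCube f) (hg : IsCube g)
    (h : ∀ ω, (∃ j, ω (φ j) = false) → f ω = g ω) :
    f (fun _ => true) = g (fun _ => true) := by
  classical
  have hρ : IsCubeMorphism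
      (fun (ω : Fin (r + 2) → Bool) i => if h : ∃ j, φ j = i then ω h.choose else true) := by
    intro i
    by_cases hi : ∃ j, φ j = i
    · exact Or.inr (Or.inr (Or.inl ⟨hi.choose, fun x => by simp [hi]⟩))
    · exact Or.inr (Or.inl fun x => by simp [hi])
  have key := uniqueness _ (isCube_iff_mem.1 (hf.comp hρ)) _ (isCube_iff_mem.1 (hg.comp hρ)) ?_
  · convert congrFun key (DCube.one _) using 2 <;> funext i <;> split_ifs <;> rfl
  · intro ω hω
    obtain ⟨j, hj⟩ := Function.ne_iff.1 hω
    refine h _ ⟨j, ?_⟩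
    have hex : ∃ j', φ j' = φ j := ⟨j, rfl⟩
    rw [dif_pos hex, φ.injective hex.choose_spec]
    simpa [DCube.one] using hj

variable (r) in
open Classical in
/-- The map on `{0,1}^(r+2)`, its coordinates indexed by `Option (Fin (r + 1))`, with values `y`,
`y'` on the edge of direction `none` through the top vertex, and values `x`, `x'` on the other
edges of direction `none`. The two vertices of the former edge are `Option.isSome` and
`fun _ => true`. -/
noncomputable def edgeConfig (x y x' y' : X) (ω : Option (Fin (r + 1)) → Bool) : X :=
  if Option.isSome ≤ ω then (if ω none then y' else y) else (if ω none then x' else x)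

variable (r) in
/-- The pairs `(x, y)` and `(x', y')` are parallel: `edgeConfig` is a cube. Both pairs then lie in
fibres of the projection to the canonical factor, and `y'` is obtained from `x'` by the translation
of the fibres that takes `x` to `y`. -/
def Parallel (x y x' y' : X) : Prop := IsCube (edgeConfig r x y x' y')

theorem eq_of_isSome_le {ω : Option ι → Bool} (h : Option.isSome ≤ ω) :
    (ω none = false → ω = Option.isSome) ∧ (ω none = true → ω = fun _ => true) := by
  have h' : ∀ i, ω (some i) = true := fun i => Bool.le_iff_imp.1 (h (some i)) rfl
  exact ⟨fun h0 => funext fun o => by cases o <;> simp [h0, h'],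
    fun h0 => funext fun o => by cases o <;> simp [h0, h']⟩

theorem isSome_le_true : (Option.isSome : Option ι → Bool) ≤ fun _ => true :=
  fun _ => Bool.le_true _

/-- Reflection in the direction `none`. -/
theorem Parallel.swap {x y x' y' : X} (h : Parallel r x y x' y') : Parallel r x' y' x y := by
  unfold Parallel
  convert IsCube.comp h
    (ρ := fun (ω : Option (Fin (r + 1)) → Bool) o => if o.isSome then ω o else !(ω o)) ?_ using 1
  · funext ω
    have e : (Option.isSome ≤ fun o => if o.isSome then ω o else !(ω o)) ↔ Option.isSome ≤ ω := by
      rw [Pi.le_def, Pi.le_def]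
      refine forall_congr' fun o => ?_
      cases o <;> simp
    unfold edgeConfig
    by_cases h1 : Option.isSome ≤ ω
    · rw [if_pos h1, if_pos (e.2 h1)]
      cases h0 : ω none <;> simp [h0]
    · rw [if_neg h1, if_neg (mt e.1 h1)]
      cases h0 : ω none <;> simp [h0]
  · intro o
    cases o
    · exact Or.inr (Or.inr (Or.inr ⟨none, fun x => rfl⟩))
    · exact Or.inr (Or.inr (Or.inl ⟨_, fun x => rfl⟩))

variable [ErgodicNilspace X r]

/-- Any two cubes that differ only on the top edge witness that two pairs are parallel. -/
theorem Parallel.of_cubes {c c' : (Option (Fin (r + 1)) → Bool) → X} (hc : IsCube c)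
    (hc' : IsCube c') (h : ∀ ω, ¬ Option.isSome ≤ ω → c ω = c' ω) :
    Parallel r (c Option.isSome) (c' Option.isSome) (c fun _ => true) (c' fun _ => true) := by
  classical
  have hd := isCube_pair (r := r) (ι := Option (Fin (r + 1))) none
    (c Option.isSome) (c fun _ => true)
  unfold Parallel
  convert isCube_replace (completion r) Option.isSome hc hc' hd h ?_ using 1
  · funext ω
    unfold edgeConfig
    split_ifs with h1 h2
    · rw [(eq_of_isSome_le h1).2 h2]
    · rw [(eq_of_isSome_le h1).1 (by simpa using h2)]
    · rfl
    · rfl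
  · intro ω h1
    split_ifs with h2
    · rw [(eq_of_isSome_le h1).2 h2]
    · rw [(eq_of_isSome_le h1).1 (by simpa using h2)]

open Classical in
theorem Parallel.isCube_replace {y y' : X} {c : (Option (Fin (r + 1)) → Bool) → X} (hc : IsCube c)
    (h : Parallel r (c Option.isSome) y (c fun _ => true) y') :
    IsCube (fun ω => if Option.isSome ≤ ω then (if ω none then y' else y) else c ω) := by
  have hd := isCube_pair (r := r) (ι := Option (Fin (r + 1))) none
    (c Option.isSome) (c fun _ => true)
  convert CubeStructure.isCube_replace (completion r) Option.isSome hd h hc ?_ ?_ using 3 with ω h1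
  · simp [edgeConfig, h1]
  · intro ω h1
    simp [edgeConfig, h1]
  · intro ω h1
    split_ifs with h2
    · rw [(eq_of_isSome_le h1).2 h2]
    · rw [(eq_of_isSome_le h1).1 (by simpa using h2)]

theorem Parallel.refl (x x' : X) : Parallel r x x x' x' := by
  unfold Parallel edgeConfig
  simpa using isCube_pair (r := r) (ι := Option (Fin (r + 1))) none x x'

theorem Parallel.trans {x y z x' y' z' : X} (h : Parallel r x y x' y')
    (h' : Parallel r y z y' z') : Parallel r x z x' z' := by
  classical
  have hd := isCube_pair (r := r) (ι := Option (Fin (r + 1))) none x x'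
  have h2 := Parallel.isCube_replace (r := r) (y := z) (y' := z') h (by
    simpa [edgeConfig, isSome_le_true] using h')
  have := Parallel.of_cubes hd h2 fun ω h1 => by simp [edgeConfig, h1]
  simpa [isSome_le_true] using this

/-- Gluing along the direction `none`. -/
theorem Parallel.glue {x y x' y' x'' y'' : X} (h : Parallel r x y x' y')
    (h' : Parallel r x' y' x'' y'') : Parallel r x y x'' y'' := by
  classical
  have h0 := h.swap
  unfold Parallel at *
  have key := isCube_outer (completion r) (fun p : Option (Fin (r + 1)) → Option Bool =>
    if ∀ i, p (some i) = some true then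
      (if p none = none then y' else if p none = some true then y'' else y) else
      (if p none = none then x' else if p none = some true then x'' else x)) ?_
  · convert key using 2 with ω
    simp [edgeConfig, Pi.le_def, Option.forall, Bool.le_iff_imp]
  · intro ε
    have hρ : IsCubeMorphism (fun (ω : Option (Fin (r + 1)) → Bool) o =>
        if o.isSome then ε o && ω o else ω o) := by
      rintro (_ | i)
      · exact Or.inr (Or.inr (Or.inl ⟨none, fun x => rfl⟩))
      · by_cases hi : ε (some i) = true
        · exact Or.inr (Or.inr (Or.inl ⟨some i, fun x => by simp [hi]⟩))
        · exact Or.inl fun x => by simp [hi]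
    have e : ∀ ω : Option (Fin (r + 1)) → Bool,
        (∀ i, (if ω (some i) then some (ε (some i)) else none) = some true) ↔
          Option.isSome ≤ fun o => if o.isSome then ε o && ω o else ω o := by
      intro ω
      simp only [Pi.le_def, Option.forall, Bool.le_iff_imp]
      simp [and_comm]
    cases hε : ε none
    · convert IsCube.comp h0 hρ using 2 with ω
      unfold edgeConfig
      simp only [e, hε]
      cases ω none <;> simp
    · convert IsCube.comp h' hρ using 2 with ω
      unfold edgeConfig
      simp only [e, hε]
      cases ω none <;> simp

theorem Parallel.canonicalRel {x y x' y' : X} (h : Parallel r x y x' y') :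
    CanonicalRel X r x y := by
  rw [canonicalRel_iff (completion r)]
  convert IsCube.comp h
    (ρ := fun (ω : Fin (r + 1) → Bool) o => o.elim false ω) ?_ using 2 with ω
  · simp [edgeConfig, Pi.le_def, Option.forall, Bool.le_iff_imp]
  · rintro (_ | i)
    · exact Or.inl fun x => rfl
    · exact Or.inr (Or.inr (Or.inl ⟨i, fun x => rfl⟩))

theorem Parallel.of_canonicalRel {x y : X} (h : CanonicalRel X r x y) : Parallel r x y x y := by
  rw [canonicalRel_iff (completion r)] at h
  unfold Parallel
  convert IsCube.comp h
    (ρ := fun (ω : Option (Fin (r + 1)) → Bool) i => ω (some i)) ?_ using 2 with ω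
  · simp [edgeConfig, Pi.le_def, Option.forall, Bool.le_iff_imp]
  · exact fun i => Or.inr (Or.inr (Or.inl ⟨some i, fun x => rfl⟩))

/-- Completion of the corner of `edgeConfig` below the top vertex. -/
theorem exists_parallel {x y : X} (h : CanonicalRel X r x y) (x' : X) :
    ∃ y', Parallel r x y x' y' := by
  classical
  have hcorner : ∀ i, (fun _ => true : Option (Fin (r + 1)) → Bool) i = true →
      IsCube (fun ω => edgeConfig r x y x' y
        (facePoint (fun _ => true) (Function.update ω i false) fun _ => true)) := by
    rintro (_ | i) -
    · convert IsCube.comp ((canonicalRel_iff (completion r)).1 h)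
        (ρ := fun (ω : Option (Fin (r + 1)) → Bool) i => ω (some i)) ?_ using 2 with ω
      · simp [edgeConfig, facePoint, Pi.le_def, Option.forall, Bool.le_iff_imp]
      · exact fun i => Or.inr (Or.inr (Or.inl ⟨some i, fun x => rfl⟩))
    · convert isCube_pair (r := r) (ι := Option (Fin (r + 1))) none x x' using 2 with ω
      have : ¬ (Option.isSome ≤ facePoint (fun _ => true) (Function.update ω (some i) false)
          fun _ => true) := fun h0 => by
        simpa using Bool.le_iff_imp.1 (h0 (some i)) rfl
      unfold edgeConfig
      rw [if_neg this]
      simp [facePoint]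
  obtain ⟨c, hc, h1⟩ := exists_isCube_of_corner (completion r) _ _ _ hcorner
  refine ⟨c fun _ => true, ?_⟩
  unfold Parallel
  convert hc using 1
  funext ω
  by_cases hω : (fun _ => true) ≤ ω
  · rw [true_le_iff.1 hω]
    simp [edgeConfig, isSome_le_true]
  · rw [h1 ω hω]
    by_cases h2 : Option.isSome ≤ ω
    · have h3 : ω none = false := by
        by_contra h3
        exact hω ((eq_of_isSome_le h2).2 (by simpa using h3)).ge
      simp [edgeConfig, facePoint, h2, h3]
    · simp [edgeConfig, facePoint, h2]

theorem Parallel.unique {x y x' y' z' : X} (h : Parallel r x y x' y') (h' : Parallel r x y x' z') :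
    y' = z' := by
  have e : Fin (r + 2) ≃ Option (Fin (r + 1)) := finSuccEquiv (r + 1)
  have := eq_of_eq_off_top (r := r) e.toEmbedding h h' fun ω hω => by
    obtain ⟨j, hj⟩ := hω
    unfold edgeConfig
    split_ifs with h1 h2
    · have := congrFun ((eq_of_isSome_le h1).2 h2) (e j)
      simp_all
    · rfl
    · rfl
    · rfl
  simpa [edgeConfig, isSome_le_true] using this

end CubeStructure

/-! ### The structure group -/

namespace CubeStructure

open ErgodicNilspace

variable {X : Type u} [CubeStructure X] {r : ℕ}

variable (r) in
/-- The structure group, realized on the fibre of a base point `e`: the point `a` stands for the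
translation of the fibres that takes `e` to `a`. -/
def StructureGroup (e : X) : Type u := {a : X // CanonicalRel X r e a}

namespace StructureGroup

variable {e : X} [ErgodicNilspace X r]

noncomputable instance : VAdd (StructureGroup r e) X where
  vadd a x := (exists_parallel a.2 x).choose

theorem parallel_vadd (a : StructureGroup r e) (x : X) : Parallel r e a.1 x (a +ᵥ x) :=
  (exists_parallel a.2 x).choose_spec

theorem vadd_eq_iff {a : StructureGroup r e} {x y : X} : a +ᵥ x = y ↔ Parallel r e a.1 x y :=
  ⟨fun h => h ▸ parallel_vadd a x, fun h => (parallel_vadd a x).unique h⟩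

theorem canonicalRel_vadd (a : StructureGroup r e) (x : X) : CanonicalRel X r x (a +ᵥ x) :=
  (parallel_vadd a x).swap.canonicalRel

theorem exists_vadd_eq {x y : X} (h : CanonicalRel X r x y) :
    ∃ a : StructureGroup r e, a +ᵥ x = y := by
  obtain ⟨a, ha⟩ := exists_parallel h e
  exact ⟨⟨a, ha.swap.canonicalRel⟩, vadd_eq_iff.2 ha.swap⟩

theorem ext_of_vadd_eq {a b : StructureGroup r e} {x : X} (h : a +ᵥ x = b +ᵥ x) : a = b := by
  have ha := (parallel_vadd a x).swap
  rw [h] at ha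
  exact Subtype.ext (ha.unique (parallel_vadd b x).swap)

@[simp]
theorem vadd_base (a : StructureGroup r e) : a +ᵥ e = a.1 :=
  vadd_eq_iff.2 (Parallel.of_canonicalRel a.2)

/-! ### Translations along edges -/

open Classical in
/-- By gluing, the two ends of the top edge are moved along parallel pairs, so that replacement
applies. -/
theorem isCube_vadd_top_edge (a : StructureGroup r e) {c : (Option (Fin (r + 1)) → Bool) → X}
    (hc : IsCube c) : IsCube (fun ω => if Option.isSome ≤ ω then a +ᵥ c ω else c ω) := by
  have h := (parallel_vadd a (c Option.isSome)).swap.glue (parallel_vadd a (c fun _ => true))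
  convert h.isCube_replace hc using 3 with ω h1
  split_ifs with h2
  · rw [(eq_of_isSome_le h1).2 h2]
  · rw [(eq_of_isSome_le h1).1 (by simpa using h2)]

open Classical in
theorem isCube_vadd_edge (a : StructureGroup r e) {ι : Type*} [Fintype ι]
    (hι : Fintype.card ι = r + 2) (j : ι) (β : ι → Bool) {c : (ι → Bool) → X} (hc : IsCube c) :
    IsCube (fun ω => if ∀ i, i ≠ j → ω i = β i then a +ᵥ c ω else c ω) := by
  obtain ⟨φ, hφ⟩ : ∃ φ : ι ≃ Option (Fin (r + 1)), φ j = none := by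
    have φ : ι ≃ Option (Fin (r + 1)) := Fintype.equivOfCardEq (by simp [hι])
    exact ⟨φ.trans (Equiv.swap (φ j) none), by simp⟩
  -- Reflect the coordinates so that the edge becomes the one through the top vertex.
  have h1 : IsCubeMorphism (fun (ω : Option (Fin (r + 1)) → Bool) i =>
      if β i then ω (φ i) else !(ω (φ i))) := by
    intro i
    by_cases hi : β i = true
    · exact Or.inr (Or.inr (Or.inl ⟨φ i, fun x => by simp [hi]⟩))
    · exact Or.inr (Or.inr (Or.inr ⟨φ i, fun x => by simp [hi]⟩))
  have h2 : IsCubeMorphism (fun (ω : ι → Bool) o =>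
      if β (φ.symm o) then ω (φ.symm o) else !(ω (φ.symm o))) := by
    intro o
    by_cases hi : β (φ.symm o) = true
    · exact Or.inr (Or.inr (Or.inl ⟨φ.symm o, fun x => by simp [hi]⟩))
    · exact Or.inr (Or.inr (Or.inr ⟨φ.symm o, fun x => by simp [hi]⟩))
  convert (isCube_vadd_top_edge a (hc.comp h1)).comp h2 using 2 with ω
  have e1 : (fun i => if β i then
      (if β (φ.symm (φ i)) then ω (φ.symm (φ i)) else !(ω (φ.symm (φ i)))) else
      !(if β (φ.symm (φ i)) then ω (φ.symm (φ i)) else !(ω (φ.symm (φ i))))) = ω := by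
    funext i
    cases hi : β i <;> simp [hi]
  have e2 : (Option.isSome ≤ fun o =>
      if β (φ.symm o) then ω (φ.symm o) else !(ω (φ.symm o))) ↔ ∀ i, i ≠ j → ω i = β i := by
    rw [Pi.le_def, ← φ.forall_congr_right]
    refine forall_congr' fun i => ?_
    rw [Bool.le_iff_imp, φ.symm_apply_apply]
    refine imp_congr ?_ ?_
    · rw [← not_iff_not, Bool.not_eq_true, Option.isSome_eq_false_iff, Option.isNone_iff_eq_none,
        ← hφ, φ.apply_eq_iff_eq, not_not]
    · cases β i <;> simp
  simp only [e1, e2]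

open Classical in
/-- A translation may be applied on any union of parallel edges. -/
theorem isCube_vadd_edges (a : StructureGroup r e) {ι : Type*} [Fintype ι]
    (hι : Fintype.card ι = r + 2) (j : ι) (B : (ι → Bool) → Prop)
    (hB : ∀ ω b, B (Function.update ω j b) ↔ B ω) {c : (ι → Bool) → X} (hc : IsCube c) :
    IsCube (fun ω => if B ω then a +ᵥ c ω else c ω) := by
  have key : ∀ T : Finset (ι → Bool),
      IsCube (fun ω => if ∃ β ∈ T, ∀ i, i ≠ j → ω i = β i then a +ᵥ c ω else c ω) := by
    intro T
    induction T using Finset.induction_on with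
    | empty => simpa using hc
    | insert β T _ ih =>
      by_cases hβ : ∃ β' ∈ T, ∀ i, i ≠ j → β i = β' i
      · convert ih using 3 with ω
        rw [Finset.exists_mem_insert, or_iff_right_of_imp]
        rintro h
        obtain ⟨β', hβ', h'⟩ := hβ
        exact ⟨β', hβ', fun i hi => (h i hi).trans (h' i hi)⟩
      · convert isCube_vadd_edge a hι j β ih using 2 with ω
        by_cases h : ∀ i, i ≠ j → ω i = β i
        · rw [if_pos ⟨β, Finset.mem_insert_self _ _, h⟩, if_pos h, if_neg]
          rintro ⟨β', hβ', h'⟩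
          exact hβ ⟨β', hβ', fun i hi => (h i hi).symm.trans (h' i hi)⟩
        · rw [if_neg h]
          simp only [Finset.exists_mem_insert, h, false_or]
  convert key (Finset.univ.filter B) using 3 with ω
  refine ⟨fun h => ⟨ω, by simpa using h, fun _ _ => rfl⟩, ?_⟩
  rintro ⟨β, hβ, h⟩
  rw [Finset.mem_filter] at hβ
  have : Function.update ω j (β j) = β := by
    funext i
    by_cases hi : i = j
    · subst hi; simp
    · rw [Function.update_of_ne hi, h i hi]
  rw [← hB ω (β j), this]
  exact hβ.2

/-- Translations commute: apply them along two edges of `{0,1}^(r+2)` that meet only at the top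
vertex; by uniqueness the value there does not depend on the order. -/
theorem vadd_comm (a b : StructureGroup r e) (x : X) : a +ᵥ (b +ᵥ x) = b +ᵥ (a +ᵥ x) := by
  have hcard : Fintype.card (Option (Fin (r + 1))) = r + 2 := by simp
  have h₁ := isCube_vadd_edge a hcard none (fun _ => true)
    (isCube_vadd_edge b hcard (some 0) (fun _ => true) (isCube_const x))
  have h₂ := isCube_vadd_edge b hcard (some 0) (fun _ => true)
    (isCube_vadd_edge a hcard none (fun _ => true) (isCube_const x))
  have key := eq_of_eq_off_top (r := r) (finSuccEquiv (r + 1)).toEmbedding h₁ h₂ ?_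
  · simpa only [implies_true, if_true] using key
  · rintro ω ⟨j, hj⟩
    replace hj : ω (finSuccEquiv (r + 1) j) = false := hj
    have hne (h1 : ∀ i, i ≠ none → ω i = true) (h2 : ∀ i, i ≠ some 0 → ω i = true) : False := by
      by_cases hji : finSuccEquiv (r + 1) j = none
      · exact Bool.false_ne_true (hj.symm.trans (h2 _ (by simp [hji])))
      · exact Bool.false_ne_true (hj.symm.trans (h1 _ hji))
    by_cases h1 : ∀ i, i ≠ none → ω i = true
    · simp only [if_pos h1, if_neg (hne h1)]
    · simp only [if_neg h1]
      split_ifs <;> rfl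

noncomputable instance : Zero (StructureGroup r e) where
  zero := ⟨e, (equivalence_canonicalRel (completion r)).refl e⟩

noncomputable instance : Add (StructureGroup r e) where
  add a b := ⟨a +ᵥ b.1,
    (equivalence_canonicalRel (completion r)).trans b.2 (canonicalRel_vadd a b.1)⟩

noncomputable instance : Neg (StructureGroup r e) where
  neg a := (exists_vadd_eq (e := e) ((equivalence_canonicalRel (completion r)).symm a.2)).choose

theorem val_add (a b : StructureGroup r e) : (a + b).1 = a +ᵥ b.1 := rfl

theorem neg_vadd_val (a : StructureGroup r e) : -a +ᵥ a.1 = e :=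
  (exists_vadd_eq (e := e) ((equivalence_canonicalRel (completion r)).symm a.2)).choose_spec

theorem zero_vadd' (x : X) : (0 : StructureGroup r e) +ᵥ x = x :=
  vadd_eq_iff.2 (Parallel.refl e x)

theorem add_vadd' (a b : StructureGroup r e) (x : X) : (a + b) +ᵥ x = a +ᵥ (b +ᵥ x) :=
  vadd_eq_iff.2 ((parallel_vadd b x).trans
    ((parallel_vadd a b.1).swap.glue (parallel_vadd a (b +ᵥ x))))

noncomputable instance : AddCommGroup (StructureGroup r e) where
  add_assoc a b c := Subtype.ext (add_vadd' a b c.1)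
  zero_add a := Subtype.ext (zero_vadd' a.1)
  add_zero a := Subtype.ext (vadd_base a)
  add_comm a b := Subtype.ext (by
    rw [val_add, val_add, ← vadd_base a, ← vadd_base b, vadd_comm])
  neg_add_cancel a := Subtype.ext (neg_vadd_val a)
  nsmul := nsmulRec
  zsmul := zsmulRec

noncomputable instance : AddAction (StructureGroup r e) X where
  zero_vadd := zero_vadd'
  add_vadd := add_vadd'

/-! ### Topology on the structure group -/

section Topology

theorem _root_.continuous_of_isClosed_graph_of_compactSpace {Y Z : Type*} [TopologicalSpace Y]
    [TopologicalSpace Z] [CompactSpace Z] {f : Y → Z} (h : IsClosed {p : Y × Z | f p.1 = p.2}) :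
    Continuous f := by
  refine continuous_iff_isClosed.2 fun C hC => ?_
  convert isClosedMap_fst_of_compactSpace _ (h.inter (hC.preimage continuous_snd)) using 1
  ext y
  simp

variable {X : Type u} [MetricSpace X] [Cubespace X] {e : X} [ErgodicNilspace X r]

instance : TopologicalSpace (StructureGroup r e) :=
  inferInstanceAs (TopologicalSpace {a : X // CanonicalRel X r e a})

instance : T2Space (StructureGroup r e) :=
  inferInstanceAs (T2Space {a : X // CanonicalRel X r e a})

theorem isClosed_graph_vadd :
    IsClosed {p : (StructureGroup r e × X) × X | p.1.1 +ᵥ p.1.2 = p.2} := by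
  classical
  simp only [vadd_eq_iff]
  -- The condition to be a cube is closed after an enumeration of the coordinates.
  have h (x y x' y' : X) : Parallel r x y x' y' ↔
      (fun ω : DCube (r + 2) => edgeConfig r x y x' y' (ω ∘ (finSuccEquiv (r + 1)).symm)) ∈
        cubes (X := X) (r + 2) := by
    rw [← isCube_iff_mem]
    refine ⟨fun h => IsCube.comp h fun i => Or.inr (Or.inr (Or.inl ⟨_, fun x => rfl⟩)), fun h => ?_⟩
    unfold Parallel
    convert h.comp (ρ := fun ω => ω ∘ finSuccEquiv (r + 1))
      fun i => Or.inr (Or.inr (Or.inl ⟨_, fun x => rfl⟩)) using 2 with ω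
    simp [Function.comp_assoc]
  simp only [h]
  refine (Cubespace.isClosed_cubes (r + 2)).preimage
    (f := fun (p : (StructureGroup r e × X) × X) (ω : DCube (r + 2)) =>
      edgeConfig r e p.1.1.1 p.1.2 p.2 (ω ∘ (finSuccEquiv (r + 1)).symm)) ?_
  refine continuous_pi fun ω => ?_
  unfold edgeConfig
  split_ifs
  · exact continuous_snd
  · exact continuous_subtype_val.comp (continuous_fst.comp continuous_fst)
  · exact continuous_snd.comp continuous_fst
  · exact continuous_const

variable [CompactSpace X]

instance : CompactSpace (StructureGroup r e) :=
  isCompact_iff_compactSpace.1 (((isClosed_canonicalRel (completion r)).preimage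
    (f := fun a : X => (e, a)) (by fun_prop)).isCompact)

instance : ContinuousVAdd (StructureGroup r e) X where
  continuous_vadd := continuous_of_isClosed_graph_of_compactSpace isClosed_graph_vadd

instance : IsTopologicalAddGroup (StructureGroup r e) where
  continuous_add := continuous_induced_rng.2
    (continuous_fst.vadd (continuous_subtype_val.comp continuous_snd))
  continuous_neg := by
    refine continuous_of_isClosed_graph_of_compactSpace ?_
    have h : Continuous fun p : StructureGroup r e × StructureGroup r e => p.2 +ᵥ p.1.1 :=
      continuous_snd.vadd (continuous_subtype_val.comp continuous_fst)
    convert isClosed_eq h (continuous_const (y := e)) using 1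
    ext p
    rw [Set.mem_ofPred_eq, Set.mem_ofPred_eq, neg_eq_iff_add_eq_zero, add_comm]
    exact ⟨fun h => congrArg Subtype.val h, fun h => Subtype.ext h⟩

end Topology

end StructureGroup

end CubeStructure

/-! ### The Host–Kra cubes of the structure group -/

namespace CubeStructure

open ErgodicNilspace

variable {X : Type u} [CubeStructure X] {r : ℕ} {ι : Type*}

theorem exists_embedding_of_le_card [Fintype ι] {n : ℕ} {v : ι → Bool}
    (h : n ≤ (Finset.univ.filter fun i => v i = true).card) :
    ∃ φ : Fin n ↪ ι, ∀ j, v (φ j) = true := by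
  obtain ⟨φ⟩ : Nonempty (Fin n ↪ {i // v i = true}) :=
    Function.Embedding.nonempty_of_card_le (by simpa [Fintype.card_subtype] using h)
  exact ⟨φ.trans (Function.Embedding.subtype _), fun j => (φ j).2⟩

/-- A map is a cube as soon as its restrictions to all faces of dimension `r + 2` are cubes: on a
larger face the corner below the top vertex is a cube by induction, and uniqueness on a face of
dimension `r + 2` through the top vertex identifies the value there. -/
theorem isCube_of_faces [ErgodicNilspace X r] [Fintype ι] [DecidableEq ι] (f : (ι → Bool) → X)
    (hι : r + 2 ≤ Fintype.card ι)
    (h : ∀ v b : ι → Bool, (Finset.univ.filter fun i => v i = true).card = r + 2 →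
      IsCube (fun ω => f (facePoint v ω b))) : IsCube f := by
  suffices key : ∀ n, r + 2 ≤ n → ∀ v b : ι → Bool,
      (Finset.univ.filter fun i => v i = true).card = n → IsCube (fun ω => f (facePoint v ω b)) by
    simpa using key _ hι (fun _ => true) (fun _ => true) (by simp [Finset.card_univ])
  intro n hn
  induction n, hn using Nat.le_induction with
  | base => exact h
  | succ n hn ih =>
    intro v b hv
    obtain ⟨c, hc, hcf⟩ := exists_isCube_of_corner (completion r) f v b fun i hi => by
      convert ih (Function.update v i false) (Function.update b i false) ?_ using 3 with ω
      · funext j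
        by_cases hj : j = i
        · subst hj; simp [facePoint, hi]
        · simp [facePoint, Function.update_of_ne hj]
      · have : (Finset.univ.filter fun j => Function.update v i false j = true) =
            (Finset.univ.filter fun j => v j = true).erase i := by
          ext j
          by_cases hj : j = i
          · subst hj; simp
          · simp [hj]
        rw [this, Finset.card_erase_of_mem (by simpa using hi), hv]
        rfl
    set t : ι → Bool := facePoint v (fun _ => true) b with ht
    have htop : c (fun _ => true) = f t := by
      obtain ⟨φ, hφ⟩ := exists_embedding_of_le_card (v := v) (n := r + 2) (by omega)
      set w : ι → Bool := fun i => decide (i ∈ Set.range φ) with hw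
      have hwφ : ∀ j, w (φ j) = true := fun j => by simp [hw]
      have hwv : ∀ i, w i = true → v i = true := fun i hi => by
        obtain ⟨j, rfl⟩ : i ∈ Set.range φ := by simpa [hw] using hi
        exact hφ j
      have hcard : (Finset.univ.filter fun i => w i = true).card = r + 2 := by
        have : (Finset.univ.filter fun i => w i = true) = Finset.univ.map φ := by
          ext i
          simp [hw]
        rw [this, Finset.card_map, Finset.card_univ, Fintype.card_fin]
      have := eq_of_eq_off_top φ (hc.comp (isCubeMorphism_facePoint w fun _ => true))
        (h w t hcard) ?_
      · convert this using 2
        · funext i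
          simp [facePoint]
        · funext i
          by_cases hi : w i = true
          · simp [facePoint, hi, ht, hwv i hi]
          · simp [facePoint, hi]
      · rintro ω ⟨j, hj⟩
        rw [hcf]
        · congr 1
          funext i
          by_cases hi : w i = true
          · simp [facePoint, hi, hwv i hi]
          · by_cases hi' : v i = true <;> simp [facePoint, hi, hi', ht]
        · intro h0
          have := Bool.le_iff_imp.1 (h0 (φ j)) (hφ j)
          simp [facePoint, hwφ, hj] at this
    convert hc.comp (isCubeMorphism_facePoint v fun _ => true) using 2 with ω
    by_cases hω : v ≤ ω
    · have e1 : facePoint v ω (fun _ => true) = fun _ => true := by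
        funext i
        have := Bool.le_iff_imp.1 (hω i)
        cases hi : v i <;> simp_all [facePoint]
      have e2 : facePoint v ω b = t := by
        funext i
        have := Bool.le_iff_imp.1 (hω i)
        cases hi : v i <;> simp_all [facePoint]
      rw [e1, e2, htop]
    · rw [hcf]
      · congr 1
        funext i
        by_cases hi : v i = true <;> simp [facePoint, hi]
      · refine fun h0 => hω fun i => ?_
        have := h0 i
        cases hi : v i <;> simp_all [facePoint]

namespace StructureGroup

variable [ErgodicNilspace X r] {e : X}

open Classical in
/-- A translation may be applied on any upper face of codimension at most `r + 1`. -/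
theorem isCube_vadd_upperFace [Fintype ι] (a : StructureGroup r e) (S : Finset ι)
    (hS : S.card ≤ r + 1) {c : (ι → Bool) → X} (hc : IsCube c) :
    IsCube (fun ω => if ∀ i ∈ S, ω i = true then a +ᵥ c ω else c ω) := by
  -- An intersection of the upper face with a face of dimension `r + 2` is a union of parallel
  -- edges. Dummy coordinates ensure that the dimension is at least `r + 2`.
  suffices h : IsCube (fun ω : ι ⊕ Fin (r + 2) → Bool =>
      if ∀ i ∈ S, ω (Sum.inl i) = true then a +ᵥ c (ω ∘ Sum.inl) else c (ω ∘ Sum.inl)) by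
    convert h.comp (ρ := fun ω : ι → Bool => Sum.elim ω fun _ => false) ?_ using 2 with ω
    · rfl
    · rintro (i | i)
      · exact Or.inr (Or.inr (Or.inl ⟨i, fun x => rfl⟩))
      · exact Or.inl fun x => rfl
  refine isCube_of_faces (r := r) _ (by simp) fun v b hv => ?_
  have hcard : Fintype.card {i // v i = true} = r + 2 := by
    rw [Fintype.card_subtype, hv]
  let ext : ({i // v i = true} → Bool) → ι ⊕ Fin (r + 2) → Bool :=
    fun η i => if h : v i = true then η ⟨i, h⟩ else b i
  have hext : IsCubeMorphism fun η => ext η ∘ Sum.inl := by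
    intro i
    by_cases hi : v (Sum.inl i) = true
    · exact Or.inr (Or.inr (Or.inl ⟨⟨_, hi⟩, fun x => by simp [ext, hi]⟩))
    · by_cases hb : b (Sum.inl i) = true
      · exact Or.inr (Or.inl fun x => by simp [ext, hi, hb])
      · exact Or.inl fun x => by simpa [ext, hi] using hb
  obtain ⟨j, hj⟩ : ∃ j : {i // v i = true}, ∀ i ∈ S, Sum.inl i ≠ j.1 := by
    by_contra! h0
    have : Finset.univ.filter (fun i => v i = true) ⊆ S.map Function.Embedding.inl := by
      intro i hi
      obtain ⟨k, hk, hki⟩ := h0 ⟨i, by simpa using hi⟩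
      exact Finset.mem_map.2 ⟨k, hk, hki⟩
    have := Finset.card_le_card this
    rw [Finset.card_map] at this
    omega
  have key := isCube_vadd_edges a hcard j (fun η => ∀ i ∈ S, ext η (Sum.inl i) = true)
    (fun η t => ?_) (hc.comp hext)
  · convert key.comp (ρ := fun (ω : ι ⊕ Fin (r + 2) → Bool) i => ω i.1)
      (fun i => Or.inr (Or.inr (Or.inl ⟨i.1, fun x => rfl⟩))) using 2 with ω
    have : facePoint v ω b = ext fun i => ω i.1 := by
      funext i
      by_cases hi : v i = true <;> simp [ext, facePoint, hi]
    rw [this]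
    split_ifs <;> rfl
  · refine forall₂_congr fun i hi => ?_
    by_cases h1 : v (Sum.inl i) = true
    · have : (⟨Sum.inl i, h1⟩ : {i // v i = true}) ≠ j :=
        fun h0 => hj i hi (congrArg Subtype.val h0)
      simp only [ext, dif_pos h1, Function.update, dif_neg this]
    · simp [ext, h1]

theorem vadd_mem_cubes {k : ℕ} {a : DCube k → StructureGroup r e}
    (ha : a ∈ degreeCubes (StructureGroup r e) (r + 1) k) :
    ∀ c ∈ cubes (X := X) k, (fun ω => a ω +ᵥ c ω) ∈ cubes (X := X) k := by
  classical
  -- Inverses are included so that the claim is visibly stable under negation.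
  suffices h : (∀ c ∈ cubes (X := X) k, (fun ω => a ω +ᵥ c ω) ∈ cubes (X := X) k) ∧
      ∀ c ∈ cubes (X := X) k, (fun ω => (-a) ω +ᵥ c ω) ∈ cubes (X := X) k from h.1
  have hface (S : Finset (Fin k)) (hS : S.card ≤ r + 1) (x : StructureGroup r e) :
      ∀ c ∈ cubes (X := X) k, (fun ω => upperFaceConfig S x ω +ᵥ c ω) ∈ cubes (X := X) k := by
    intro c hc
    convert isCube_iff_mem.1 (isCube_vadd_upperFace x S hS (isCube_iff_mem.2 hc)) using 2 with ω
    unfold upperFaceConfig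
    split_ifs <;> simp
  unfold degreeCubes hostKra at ha
  induction ha using AddSubgroup.closure_induction with
  | mem a ha =>
    obtain ⟨S, x, hx, rfl⟩ := ha
    have hneg : -upperFaceConfig S x = upperFaceConfig S (-x) := by
      funext ω
      simp only [upperFaceConfig, Pi.neg_apply]
      split_ifs <;> simp
    by_cases hS : S.card ≤ r + 1
    · rw [hneg]
      exact ⟨hface S hS x, hface S hS (-x)⟩
    · obtain rfl : x = 0 := by simpa [degreeFiltration, hS] using hx
      rw [hneg, neg_zero]
      have h0 : upperFaceConfig S (0 : StructureGroup r e) = 0 := by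
        funext ω
        simp [upperFaceConfig]
      rw [h0]
      simp
  | zero => simp
  | add a b _ _ iha ihb =>
    refine ⟨fun c hc => ?_, fun c hc => ?_⟩
    · simpa only [Pi.add_apply, add_vadd] using iha.1 _ (ihb.1 c hc)
    · simpa only [neg_add, Pi.add_apply, add_vadd] using iha.2 _ (ihb.2 c hc)
  | neg a _ iha => exact ⟨iha.2, by simpa only [neg_neg] using iha.1⟩

theorem upperFaceConfig_mem_degreeCubes {A : Type u} [AddCommGroup A] {s k : ℕ}
    {S : Finset (Fin k)} (hS : S.card ≤ s) (x : A) : upperFaceConfig S x ∈ degreeCubes A s k :=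
  AddSubgroup.subset_closure ⟨S, x, by simp [degreeFiltration, hS], rfl⟩

/-- Two cubes with values in the same fibres differ by a Host–Kra cube of the structure group. The
Host–Kra cube is corrected at one vertex after another, in increasing order: at a vertex of weight
at most `r + 1` by a generator, while at a vertex of larger weight uniqueness shows that no
correction is needed. -/
theorem exists_degreeCubes_vadd_eq {k : ℕ} {c c' : DCube k → X} (hc : c ∈ cubes (X := X) k)
    (hc' : c' ∈ cubes (X := X) k) (h : ∀ ω, CanonicalRel X r (c ω) (c' ω)) :
    ∃ a ∈ degreeCubes (StructureGroup r e) (r + 1) k, c' = fun ω => a ω +ᵥ c ω := by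
  obtain ⟨a, ha, hac⟩ : ∃ a ∈ degreeCubes (StructureGroup r e) (r + 1) k,
      ∀ ω ∈ Set.univ, c' ω = a ω +ᵥ c ω := by
    refine lowerSet_induction (P := fun D => ∃ a ∈ degreeCubes (StructureGroup r e) (r + 1) k,
      ∀ ω ∈ D, c' ω = a ω +ᵥ c ω) ?_ ∅ isLowerSet_empty ⟨0, zero_mem _, by simp⟩
    rintro D v hD hv hlt ⟨a, ha, hac⟩
    by_cases hcard : (Finset.univ.filter fun i => v i = true).card ≤ r + 1
    · have equiv := equivalence_canonicalRel (X := X) (r := r) (completion r)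
      obtain ⟨x, hx⟩ := exists_vadd_eq (e := e)
        (equiv.trans (equiv.symm (canonicalRel_vadd (a v) (c v))) (h v))
      refine ⟨_, add_mem (upperFaceConfig_mem_degreeCubes hcard x) ha, ?_⟩
      rintro ω (rfl | hω)
      · rw [Pi.add_apply, add_vadd, upperFaceConfig, if_pos (by simp), hx]
      · rw [Pi.add_apply, add_vadd, upperFaceConfig, if_neg, zero_vadd, hac ω hω]
        intro h0
        refine hv (hD (fun i => Bool.le_iff_imp.2 fun hi => h0 i ?_) hω)
        simpa using hi
    · refine ⟨a, ha, ?_⟩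
      rintro ω (rfl | hω)
      · obtain ⟨φ, hφ⟩ := exists_embedding_of_le_card (v := ω) (n := r + 2) (by omega)
        have hmor := isCubeMorphism_facePoint ω fun _ => false
        have key := eq_of_eq_off_top φ ((isCube_iff_mem.2 hc').comp hmor)
          ((isCube_iff_mem.2 (vadd_mem_cubes ha c hc)).comp hmor) ?_
        · have : facePoint ω (fun _ => true) (fun _ => false) = ω := by
            funext i
            simp [facePoint]
          simpa only [this] using key
        · rintro η ⟨j, hj⟩
          refine hac _ (hlt _ (lt_of_le_of_ne (fun i => ?_) fun h0 => ?_))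
          · cases hi : ω i <;> simp [facePoint, hi]
          · have := congrFun h0 (φ j)
            simp [facePoint, hφ, hj] at this
      · exact hac ω hω
  exact ⟨a, ha, funext fun ω => hac ω (Set.mem_univ _)⟩

end StructureGroup

end CubeStructure

/-! ### The weak structure theorem -/

theorem theorem4p2 {X : Type u} [MetricSpace X] [CompactSpace X] [Cubespace X]
    (s : ℕ) (hs : 1 ≤ s)
    (hergodic : CubeStructure.IsErgodic X)
    (hnil : CubeStructure.IsNilspaceOfDegree X s) :
    -- the relation defining the canonical factor is a closed equivalence relation
    (Equivalence (CubeStructure.CanonicalRel X (s - 1)) ∧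
      IsClosed {p : X × X | CubeStructure.CanonicalRel X (s - 1) p.1 p.2}) ∧
    -- the structure group, a compact abelian group with a continuous action on `X`
    ∃ (A : Type u) (_ : AddCommGroup A) (_ : TopologicalSpace A) (_ : IsTopologicalAddGroup A)
      (_ : CompactSpace A) (_ : T2Space A) (_ : AddAction A X) (_ : ContinuousVAdd A X),
      -- (i) the action is free and its orbits are the fibres of the projection
      ((∀ (a : A) (x : X), a +ᵥ x = x → a = 0) ∧
        ∀ x : X, AddAction.orbit A x =
          CubeStructure.canonicalProj X (s - 1) ⁻¹' {CubeStructure.canonicalProj X (s - 1) x}) ∧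
      -- (ii) the induced pointwise actions on cubes
      ∀ k : ℕ,
        (∀ a ∈ degreeCubes A s k, ∀ c ∈ CubeStructure.cubes (X := X) k,
          (fun ω => a ω +ᵥ c ω) ∈ CubeStructure.cubes (X := X) k) ∧
        (∀ a ∈ degreeCubes A s k, ∀ c ∈ CubeStructure.cubes (X := X) k,
          (fun ω => a ω +ᵥ c ω) = c → a = 0) ∧
        ∀ c : CubeStructure.cubes (X := X) k,
          {c' : CubeStructure.cubes (X := X) k |
              ∃ a ∈ degreeCubes A s k, c'.1 = fun ω => a ω +ᵥ c.1 ω} =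
            CubeStructure.canonicalProjCubes X (s - 1) k ⁻¹'
              {CubeStructure.canonicalProjCubes X (s - 1) k c} := by
  obtain ⟨r, rfl⟩ : ∃ r, s = r + 1 := ⟨s - 1, by omega⟩
  rw [Nat.add_sub_cancel]
  have hX := hnil.1
  have equiv := CubeStructure.equivalence_canonicalRel (X := X) (r := r) hX
  have hproj : ∀ x y, CubeStructure.canonicalProj X r y = CubeStructure.canonicalProj X r x ↔
      CubeStructure.CanonicalRel X r y x := fun x y => equiv.quot_mk_eq_iff y x
  have : CubeStructure.ErgodicNilspace X r := ⟨hX, hnil.2.1, hergodic⟩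
  -- Completion in dimension `0` provides a base point.
  obtain ⟨c₀, -, -⟩ := hX 0 (fun ω => (ω.2 (Subsingleton.elim _ _)).elim) trivial
  have hfree : ∀ (a : CubeStructure.StructureGroup r (c₀ default)) (x : X), a +ᵥ x = x → a = 0 :=
    fun a x h => CubeStructure.StructureGroup.ext_of_vadd_eq (h.trans (zero_vadd _ x).symm)
  refine ⟨⟨equiv, CubeStructure.isClosed_canonicalRel hX⟩,
    CubeStructure.StructureGroup r (c₀ default), inferInstance, inferInstance, inferInstance,
    inferInstance, inferInstance, inferInstance, inferInstance, ⟨hfree, fun x => ?_⟩, fun k =>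
    ⟨fun a ha => CubeStructure.StructureGroup.vadd_mem_cubes ha, fun a _ c _ h =>
      funext fun ω => hfree _ _ (congrFun h ω), fun c => ?_⟩⟩
  · ext y
    rw [Set.mem_preimage, Set.mem_singleton_iff, hproj, AddAction.mem_orbit_iff]
    constructor
    · rintro ⟨a, rfl⟩
      exact equiv.symm (CubeStructure.StructureGroup.canonicalRel_vadd a x)
    · exact fun h => CubeStructure.StructureGroup.exists_vadd_eq (equiv.symm h)
  · ext c'
    rw [Set.mem_preimage, Set.mem_singleton_iff]
    constructor
    · rintro ⟨a, -, h⟩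
      refine Subtype.ext (funext fun ω => (hproj _ _).2 ?_)
      rw [h]
      exact equiv.symm (CubeStructure.StructureGroup.canonicalRel_vadd (a ω) (c.1 ω))
    · intro h
      refine CubeStructure.StructureGroup.exists_degreeCubes_vadd_eq c.2 c'.2 fun ω => ?_
      exact equiv.symm ((hproj _ _).1 (congrFun (congrArg Subtype.val h) ω))
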